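/- Let $n \ge 1$ be fixed and let $d = \binom{n}{2}$. A partial Hadamard matrix of dimension $n \times t$ is an $n \times t$ matrix with entries $\pm 1$ in which any two distinct rows have inner product zero; let $N_{n,t}$ be the number of such matrices. Then $$N_{n,4t} = (1+o(1))\, 2^{2d-n+4nt+1} (8\pi t)^{-d/2} \quad \text{as } t \to \infty .$$ Moreover, for $y \in \{-1,1\}^n$ let $Z(y) = (y_i y_j)_{1 \le i < j \le n} \in \mathbb{Z}^d$, and let $P_n^{t}(0,0)$ be the probability that the random walk on $\mathbb{Z}^d$ started at $0$, whose increments are independent and uniformly distributed on the set $\{Z(y) : y \in \{-1,1\}^n\}$, is at $0$ after $t$ steps. Then $$P_n^{4t}(0,0) = (1+o(1))\, 2^{2d-n+1} (8\pi t)^{-d/2} \quad \text{as } t \to \infty .$$ -/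

import Mathlib

open Filter Asymptotics

/-- An `n × t` integer matrix is a partial Hadamard matrix if all its entries are `±1` and any two
distinct rows have inner product zero. -/
def IsPartialHadamard {n t : ℕ} (A : Matrix (Fin n) (Fin t) ℤ) : Prop :=
  (∀ i k, A i k = 1 ∨ A i k = -1) ∧ ∀ i j, i ≠ j → A i ⬝ᵥ A j = 0

/-- The number of `n × t` partial Hadamard matrices. -/
noncomputable def numPartialHadamard (n t : ℕ) : ℕ :=
  {A : Matrix (Fin n) (Fin t) ℤ | IsPartialHadamard A}.ncard

/-- The pairs `i < j` of indices in `{1, …, n}`; there are `n.choose 2` of them. -/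
abbrev IndexPair (n : ℕ) : Type := {p : Fin n × Fin n // p.1 < p.2}

/-- The vector `Z(y) = (y₁y₂, y₁y₃, …, yₙ₋₁yₙ)` of all pairwise products of the components
of `y`. -/
def pairProducts {n : ℕ} (y : Fin n → ℤ) : IndexPair n → ℤ :=
  fun p => y p.1.1 * y p.1.2

/-- The set `{-1, 1}ⁿ`. -/
def signVectors (n : ℕ) : Finset (Fin n → ℤ) :=
  Fintype.piFinset fun _ => {-1, 1}

/-- The set of increments `M = {Z(y) : y ∈ {-1, 1}ⁿ}`. -/
def increments (n : ℕ) : Finset (IndexPair n → ℤ) :=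
  (signVectors n).image pairProducts

theorem increments_nonempty (n : ℕ) : (increments n).Nonempty :=
  Finset.Nonempty.image ⟨fun _ => 1, by simp [signVectors]⟩ _

/-- The law, after `t` steps, of the random walk started at `x` whose increments are independent
and uniformly distributed on `M`. -/
noncomputable def walkLaw (n : ℕ) (x : IndexPair n → ℤ) : ℕ → PMF (IndexPair n → ℤ)
  | 0 => PMF.pure x
  | t + 1 => (walkLaw n x t).bind fun z =>
      (PMF.uniformOfFinset (increments n) (increments_nonempty n)).map fun m => z + m

/-- The `t`-step transition probability `Pₙᵗ(x, y)` of the walk. -/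
noncomputable def transitionProb (n t : ℕ) (x y : IndexPair n → ℤ) : ℝ :=
  (walkLaw n x t y).toReal

/-! A partial Hadamard matrix is a list of `t` sign vectors (its columns) whose `pairProducts` sum
to zero, so the count is `2 ^ (n * t)` times the return probability. By Fourier inversion both are
integrals of `φ ^ t`, `φ = incrementCharFun n`, over a period cube of `(2πℤ)^d`. Cut that cube into
`4 ^ d` translates of `quarterCube` by `(π/2) • a` and read `a` as edge weights on the complete
graph on `n` vertices.

If every vertex degree of `a` is even, the shift multiplies `φ` by a fixed power of `I`, so `φ ^ (4
* t)` is unchanged. There are `2 ^ (2d - n + 1)` such `a` (`card_evenWeights_mul`). If some degree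
is odd, `norm_incrementCharFun_sq_le` gives `‖φ‖² ≤ 1/2` on the translate, and its contribution
decays exponentially.

On the central cube the same inequality gives Gaussian domination. Under `u = v / √t`, `φ ^ (4 * t)`
tends to `exp (-2 |v|²)`, because the increments have mean zero and identity covariance. Dominated
convergence gives `(π/2)^(d/2)` per even translate; dividing by `(2π)^d` leaves `(8π)^(-d/2)`. -/

/-! ### Orthogonality of characters over the tiled period cube. -/

section Orthogonality

open MeasureTheory

/-- The character `exp (i ⟨l, m⟩)` of `ℤ^ι` with frequency `l`. -/
noncomputable def character {ι : Type*} [Fintype ι] (l : ι → ℝ) (m : ι → ℤ) : ℂ :=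
  Complex.exp (((∑ p, l p * (m p : ℝ) : ℝ) : ℂ) * Complex.I)

/-- The cube `[-π/4, π/4]^ι`; its translates by `(π/2) • a`, `a ∈ {0, 1, 2, 3}^ι`, tile a
fundamental domain of `(2πℤ)^ι`. -/
def quarterCube (ι : Type*) : Set (ι → ℝ) :=
  Set.pi Set.univ fun _ => Set.Icc (-(Real.pi / 4)) (Real.pi / 4)

/-- Translation of `u` by `(π/2) • a`. -/
noncomputable def quarterShift {ι : Type*} (a : ι → Fin 4) (u : ι → ℝ) : ι → ℝ :=
  fun p => u p + ((a p : ℕ) : ℝ) * (Real.pi / 2)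

theorem character_eq_prod {ι : Type*} [Fintype ι] (l : ι → ℝ) (m : ι → ℤ) :
    character l m = ∏ p, Complex.exp (((m p : ℂ) * Complex.I) * (l p : ℂ)) := by
  rw [character, ← Complex.exp_sum]
  push_cast
  rw [Finset.sum_mul]
  exact congrArg _ (Finset.sum_congr rfl fun p _ => by ring)

theorem character_add {ι : Type*} [Fintype ι] (l : ι → ℝ) (m m' : ι → ℤ) :
    character l (m + m') = character l m * character l m' := by
  simp only [character_eq_prod, ← Finset.prod_mul_distrib, ← Complex.exp_add, Pi.add_apply]
  exact Finset.prod_congr rfl fun p _ => by push_cast; ring_nf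

theorem norm_character {ι : Type*} [Fintype ι] (l : ι → ℝ) (m : ι → ℤ) :
    ‖character l m‖ = 1 := Complex.norm_exp_ofReal_mul_I _

theorem continuous_character {ι : Type*} [Fintype ι] (m : ι → ℤ) :
    Continuous fun l : ι → ℝ => character l m := by
  unfold character; fun_prop

theorem continuous_quarterShift {ι : Type*} (a : ι → Fin 4) : Continuous (quarterShift a) := by
  unfold quarterShift; fun_prop

theorem isCompact_quarterCube (ι : Type*) : IsCompact (quarterCube ι) :=
  isCompact_univ_pi fun _ => isCompact_Icc

/-- The four translates are adjacent and tile `[-π/4, 7π/4]`, a full period. -/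
theorem integral_quarter_translates_exp (m : ℤ) :
    ∫ x in Set.Icc (-(Real.pi / 4)) (Real.pi / 4), ∑ k : Fin 4,
      Complex.exp (((m : ℂ) * Complex.I) * ((x + ((k : ℕ) : ℝ) * (Real.pi / 2) : ℝ) : ℂ)) =
    if m = 0 then ((2 * Real.pi : ℝ) : ℂ) else 0 := by
  set f : ℝ → ℂ := fun x => Complex.exp (((m : ℂ) * Complex.I) * (x : ℂ)) with hf
  have hfc : Continuous f := by rw [hf]; fun_prop
  have hle : -(Real.pi / 4) ≤ Real.pi / 4 := by linarith [Real.pi_pos]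
  set e : ℕ → ℝ := fun k => -(Real.pi / 4) + k * (Real.pi / 2) with he
  have htile : ∫ x in Set.Icc (-(Real.pi / 4)) (Real.pi / 4), ∑ k : Fin 4,
      f (x + ((k : ℕ) : ℝ) * (Real.pi / 2)) = ∫ x in (e 0)..(e 4), f x := by
    rw [integral_Icc_eq_integral_Ioc, ← intervalIntegral.integral_of_le hle,
      intervalIntegral.integral_finsetSum
        (f := fun (k : Fin 4) x => f (x + ((k : ℕ) : ℝ) * (Real.pi / 2))) (fun k _ => (hfc.comp (by fun_prop : Continuous fun x : ℝ =>
          x + ((k : ℕ) : ℝ) * (Real.pi / 2))).intervalIntegrable _ _),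
      ← intervalIntegral.sum_integral_adjacent_intervals
        (fun k _ => hfc.intervalIntegrable _ _), Finset.sum_range]
    refine Finset.sum_congr rfl fun k _ => ?_
    rw [intervalIntegral.integral_comp_add_right]
    congr 1
    simp only [he]; push_cast; ring
  change ∫ x in Set.Icc (-(Real.pi / 4)) (Real.pi / 4), ∑ k : Fin 4,
      f (x + ((k : ℕ) : ℝ) * (Real.pi / 2)) = _
  rw [htile]
  split_ifs with hm
  · simp only [hf, hm, he]
    simp
    ring
  · have hc : (m : ℂ) * Complex.I ≠ 0 := by simp [hm]
    simp only [hf]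
    rw [integral_exp_mul_complex hc]
    have : Complex.exp ((m : ℂ) * Complex.I * (e 4 : ℝ)) =
        Complex.exp ((m : ℂ) * Complex.I * (e 0 : ℝ)) := by
      rw [Complex.exp_eq_exp_iff_exists_int]
      refine ⟨m, ?_⟩
      simp only [he]; push_cast; ring
    rw [this, sub_self, zero_div]

/-- The sum over `a` of a product over coordinates is a product of sums, so Fubini reduces to one
variable. -/
theorem integral_quarter_translates_character {ι : Type*} [Fintype ι] [DecidableEq ι]
    (m : ι → ℤ) :
    ∫ u in quarterCube ι, ∑ a : ι → Fin 4, character (quarterShift a u) m =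
      if m = 0 then (((2 * Real.pi) ^ Fintype.card ι : ℝ) : ℂ) else 0 := by
  have h1 : ∀ u : ι → ℝ, ∑ a : ι → Fin 4, character (quarterShift a u) m =
      ∏ p, ∑ k : Fin 4, Complex.exp (((m p : ℂ) * Complex.I) *
        ((u p + ((k : ℕ) : ℝ) * (Real.pi / 2) : ℝ) : ℂ)) := fun u => by
    rw [Finset.prod_univ_sum, Fintype.piFinset_univ]
    exact Finset.sum_congr rfl fun a _ => character_eq_prod _ _
  simp only [h1]
  rw [quarterCube, volume_pi, Measure.restrict_pi_pi, integral_fintype_prod_eq_prod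
    (fun p x => ∑ k : Fin 4, Complex.exp (((m p : ℂ) * Complex.I) *
        ((x + ((k : ℕ) : ℝ) * (Real.pi / 2) : ℝ) : ℂ)))]
  simp only [integral_quarter_translates_exp]
  split_ifs with hm
  · simp [hm]
  · obtain ⟨p, hp⟩ := Function.ne_iff.mp hm
    exact Finset.prod_eq_zero (Finset.mem_univ p) (if_neg hp)

end Orthogonality

/-! ### Edge weights modulo 4, vertex degrees and sign vectors. -/

section Combinatorics

theorem card_indexPair (n : ℕ) : Fintype.card (IndexPair n) = n.choose 2 := by
  rw [Fintype.card_subtype, Finset.card_filter, Fintype.sum_prod_type_right]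
  have h : ∀ j : Fin n, ∑ i : Fin n, (if i < j then 1 else 0) = (j : ℕ) := fun j => by
    rw [← Finset.card_filter, ← Fin.card_Iio j]
    congr 1
    ext i; simp
  simp only [h]
  rw [Fin.sum_univ_eq_sum_range (fun i => i), Finset.sum_range_id, Nat.choose_two_right]

theorem mem_signVectors {n : ℕ} {y : Fin n → ℤ} :
    y ∈ signVectors n ↔ ∀ k, y k = -1 ∨ y k = 1 := by
  simp [signVectors, Fintype.mem_piFinset]

theorem card_signVectors (n : ℕ) : (signVectors n).card = 2 ^ n := by
  simp [signVectors, Fintype.card_piFinset]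

theorem sum_signVectors_prod {n : ℕ} {R : Type*} [CommSemiring R] (f : Fin n → ℤ → R) :
    ∑ y ∈ signVectors n, ∏ k, f k (y k) = ∏ k, (f k (-1) + f k 1) := by
  rw [signVectors, ← Finset.prod_univ_sum]
  exact Finset.prod_congr rfl fun k _ => Finset.sum_pair (by norm_num)

theorem mul_self_of_mem_signVectors {n : ℕ} {y : Fin n → ℤ} (hy : y ∈ signVectors n)
    (k : Fin n) : y k * y k = 1 := by
  rcases mem_signVectors.mp hy k with h | h <;> simp [h]

theorem neg_mem_signVectors {n : ℕ} {y : Fin n → ℤ} (hy : y ∈ signVectors n) :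
    -y ∈ signVectors n := by
  rw [mem_signVectors] at hy ⊢
  intro k
  rcases hy k with h | h <;> simp [h]

/-- The symmetric extension, by zero on the diagonal, of a function on pairs `i < j`. -/
def symmExt {n : ℕ} {R : Type*} [CommSemiring R] (l : IndexPair n → R) (k j : Fin n) : R :=
  ∑ p : IndexPair n, l p * ((if p.1.1 = k ∧ p.1.2 = j then 1 else 0) +
    (if p.1.1 = j ∧ p.1.2 = k then 1 else 0))

/-- The weighted degree of the vertex `k` when the pair `p` carries the weight `a p`. -/
def vertexDegree {n : ℕ} (a : IndexPair n → Fin 4) (k : Fin n) : ℕ :=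
  ∑ p : IndexPair n, (a p : ℕ) * ((if p.1.1 = k then 1 else 0) + (if p.1.2 = k then 1 else 0))

theorem symmExt_comm {n : ℕ} {R : Type*} [CommSemiring R] (l : IndexPair n → R)
    (k j : Fin n) : symmExt l k j = symmExt l j k :=
  Finset.sum_congr rfl fun p _ => by rw [add_comm]

theorem symmExt_self {n : ℕ} {R : Type*} [CommSemiring R] (l : IndexPair n → R) (k : Fin n) :
    symmExt l k k = 0 := by
  refine Finset.sum_eq_zero fun p _ => ?_
  have : ¬ (p.1.1 = k ∧ p.1.2 = k) := fun h => p.2.ne (h.1.trans h.2.symm)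
  simp [this]

theorem symmExt_pair {n : ℕ} {R : Type*} [CommSemiring R] (l : IndexPair n → R)
    (p : IndexPair n) : symmExt l p.1.1 p.1.2 = l p := by
  rw [symmExt, Finset.sum_eq_single p]
  · have : ¬ (p.1.1 = p.1.2 ∧ p.1.2 = p.1.1) := fun h => p.2.ne h.1
    simp [this]
  · intro q _ hq
    have h1 : ¬ (q.1.1 = p.1.1 ∧ q.1.2 = p.1.2) := fun h =>
      hq (Subtype.ext (Prod.ext h.1 h.2))
    have h2 : ¬ (q.1.1 = p.1.2 ∧ q.1.2 = p.1.1) := fun h => by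
      have h1 := q.2
      rw [h.1, h.2] at h1
      exact lt_asymm h1 p.2
    simp [h1, h2]
  · simp

theorem symmExt_eq_zero_or {n : ℕ} {R : Type*} [CommSemiring R] (l : IndexPair n → R)
    (k j : Fin n) : symmExt l k j = 0 ∨ ∃ p, symmExt l k j = l p := by
  rcases lt_trichotomy k j with h | h | h
  · exact .inr ⟨⟨(k, j), h⟩, symmExt_pair l ⟨(k, j), h⟩⟩
  · exact .inl (h ▸ symmExt_self l k)
  · exact .inr ⟨⟨(j, k), h⟩, symmExt_comm l k j ▸ symmExt_pair l ⟨(j, k), h⟩⟩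

theorem sum_symmExt_mul {n : ℕ} {R : Type*} [CommSemiring R] (l : IndexPair n → R)
    (k : Fin n) (g : Fin n → R) :
    ∑ j, symmExt l k j * g j = ∑ p : IndexPair n, l p *
      ((if p.1.1 = k then g p.1.2 else 0) + (if p.1.2 = k then g p.1.1 else 0)) := by
  simp only [symmExt, Finset.sum_mul]
  rw [Finset.sum_comm]
  refine Finset.sum_congr rfl fun p _ => ?_
  simp only [mul_assoc, ← Finset.mul_sum, add_mul, Finset.sum_add_distrib, ite_and, ite_mul,
    one_mul, zero_mul]
  by_cases h1 : p.1.1 = k <;> by_cases h2 : p.1.2 = k <;> simp [h1, h2]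

theorem sum_symmExt_eq_vertexDegree {n : ℕ} (a : IndexPair n → Fin 4) (k : Fin n) :
    ∑ j, symmExt (fun p => (a p : ℕ)) k j = vertexDegree a k := by
  simpa [vertexDegree] using sum_symmExt_mul (fun p => (a p : ℕ)) k (fun _ => 1)

theorem symmExt_quarterShift {n : ℕ} (a : IndexPair n → Fin 4) (u : IndexPair n → ℝ)
    (k j : Fin n) : symmExt (quarterShift a u) k j =
      symmExt u k j + (symmExt (fun p => (a p : ℕ)) k j : ℕ) * (Real.pi / 2) := by
  simp only [symmExt, quarterShift]
  push_cast
  rw [Finset.sum_mul, ← Finset.sum_add_distrib]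
  exact Finset.sum_congr rfl fun p _ => by ring

theorem sum_vertexDegree_mul {n : ℕ} (a : IndexPair n → Fin 4) (g : Fin n → ℤ) :
    ∑ k, (vertexDegree a k : ℤ) * g k =
      ∑ p : IndexPair n, ((a p : ℕ) : ℤ) * (g p.1.1 + g p.1.2) := by
  simp only [vertexDegree]
  push_cast
  simp only [Finset.sum_mul]
  rw [Finset.sum_comm]
  refine Finset.sum_congr rfl fun p _ => ?_
  simp [mul_assoc, ← Finset.mul_sum, add_mul, Finset.sum_add_distrib]

/-- The weight `a p` enters the exponents of both endpoints of `p`. -/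
theorem prod_pow_vertexDegree {n : ℕ} (a : IndexPair n → Fin 4) (y : Fin n → ℤ) :
    ∏ k, y k ^ vertexDegree a k = ∏ p : IndexPair n, pairProducts y p ^ (a p : ℕ) := by
  simp only [vertexDegree, ← Finset.prod_pow_eq_pow_sum]
  rw [Finset.prod_comm]
  refine Finset.prod_congr rfl fun p _ => ?_
  simp only [mul_comm ((a p : ℕ)), pow_mul, Finset.prod_pow, pow_add, pairProducts]
  congr 1
  rw [Finset.prod_mul_distrib]
  simp [pow_ite, Finset.prod_ite_eq]

/-- All weighted degrees of `a` are even. -/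
def IsEvenWeight {n : ℕ} (a : IndexPair n → Fin 4) : Prop := ∀ k, Even (vertexDegree a k)

-- Rewritten in vertex degrees, the sum factors over vertices into terms `(-1) ^ deg + 1`, each 2 or
-- 0.
open Classical in
theorem sum_signVectors_prod_pairProducts_pow {n : ℕ} (a : IndexPair n → Fin 4) :
    ∑ y ∈ signVectors n, ∏ p, pairProducts y p ^ (a p : ℕ) =
      if IsEvenWeight a then 2 ^ n else 0 := by
  simp only [← prod_pow_vertexDegree]
  rw [sum_signVectors_prod (fun k x => x ^ vertexDegree a k)]
  split_ifs with h
  · rw [Finset.prod_congr rfl fun k _ => by rw [(h k).neg_one_pow, one_pow]]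
    simp
  · simp only [IsEvenWeight, not_forall, Nat.not_even_iff_odd] at h
    obtain ⟨k, hk⟩ := h
    exact Finset.prod_eq_zero (Finset.mem_univ k) (by simp [hk.neg_one_pow])

theorem pairProducts_eq_iff {n : ℕ} {y x : Fin n → ℤ} (hy : y ∈ signVectors n)
    (hx : x ∈ signVectors n) : pairProducts x = pairProducts y ↔ x = y ∨ x = -y := by
  constructor
  · intro h
    have hall : ∀ i j, x i * x j = y i * y j := fun i j => by
      rcases lt_trichotomy i j with hij | hij | hij
      · exact congrFun h ⟨(i, j), hij⟩
      · rw [hij, mul_self_of_mem_signVectors hx, mul_self_of_mem_signVectors hy]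
      · rw [mul_comm, mul_comm (y i)]
        exact congrFun h ⟨(j, i), hij⟩
    by_cases hxy : x = y
    · exact .inl hxy
    · obtain ⟨i, hi⟩ := Function.ne_iff.mp hxy
      refine .inr (funext fun j => ?_)
      have h1 := hall i j
      rw [Pi.neg_apply]
      rcases mem_signVectors.mp hx i with h2 | h2 <;>
        rcases mem_signVectors.mp hy i with h3 | h3 <;> rw [h2, h3] at h1 hi
      all_goals first | exact absurd rfl hi | linarith
  · rintro (rfl | rfl)
    · rfl
    · ext p; simp [pairProducts]

/-- For `n = 0` the empty vector is its own negative; this is where `1 ≤ n` matters. -/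
theorem ne_neg_of_mem_signVectors {n : ℕ} (hn : 1 ≤ n) {y : Fin n → ℤ}
    (hy : y ∈ signVectors n) : y ≠ -y := fun h => by
  have h1 := congrFun h ⟨0, hn⟩
  have h2 := mem_signVectors.mp hy ⟨0, hn⟩
  rw [Pi.neg_apply] at h1
  omega

theorem card_fiber_pairProducts {n : ℕ} (hn : 1 ≤ n) {y : Fin n → ℤ} (hy : y ∈ signVectors n) :
    {x ∈ signVectors n | pairProducts x = pairProducts y}.card = 2 := by
  have : {x ∈ signVectors n | pairProducts x = pairProducts y} = {y, -y} := by
    ext x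
    simp only [Finset.mem_filter, Finset.mem_insert, Finset.mem_singleton]
    constructor
    · rintro ⟨hx, h⟩
      exact (pairProducts_eq_iff hy hx).mp h
    · intro h
      have hx : x ∈ signVectors n := by
        rcases h with rfl | rfl
        · exact hy
        · exact neg_mem_signVectors hy
      exact ⟨hx, (pairProducts_eq_iff hy hx).mpr h⟩
  rw [this, Finset.card_pair (ne_neg_of_mem_signVectors hn hy)]

theorem sum_signVectors_comp_pairProducts {n : ℕ} (hn : 1 ≤ n) {R : Type*} [CommSemiring R]
    (f : (IndexPair n → ℤ) → R) :
    ∑ y ∈ signVectors n, f (pairProducts y) = 2 * ∑ m ∈ increments n, f m := by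
  rw [Finset.sum_comp, Finset.mul_sum]
  refine Finset.sum_congr rfl fun m hm => ?_
  obtain ⟨y, hy, rfl⟩ := Finset.mem_image.mp hm
  rw [card_fiber_pairProducts hn hy, nsmul_eq_mul, Nat.cast_ofNat]

theorem two_mul_card_increments {n : ℕ} (hn : 1 ≤ n) : 2 * (increments n).card = 2 ^ n := by
  have := sum_signVectors_comp_pairProducts hn (fun _ => (1 : ℕ))
  simpa [card_signVectors] using this.symm

-- Double counting of one sum over pairs `(a, y)`. Summing over `y` first detects even weights;
-- summing over `a` first leaves only the two constant sign vectors.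
open Classical in
theorem card_evenWeights_mul {n : ℕ} (hn : 1 ≤ n) :
    (Finset.univ.filter fun a : IndexPair n → Fin 4 => IsEvenWeight a).card * 2 ^ n =
      2 * 4 ^ n.choose 2 := by
  have h1 : ∑ a : IndexPair n → Fin 4, ∑ y ∈ signVectors n,
      ∏ p, pairProducts y p ^ (a p : ℕ) =
      ((Finset.univ.filter fun a : IndexPair n → Fin 4 => IsEvenWeight a).card : ℤ) * 2 ^ n := by
    simp only [sum_signVectors_prod_pairProducts_pow]
    rw [← Finset.sum_filter, Finset.sum_const, nsmul_eq_mul]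
  have h2 : ∀ y ∈ signVectors n, ∑ a : IndexPair n → Fin 4,
      ∏ p, pairProducts y p ^ (a p : ℕ) =
      if pairProducts y = pairProducts (fun _ => 1) then (4 : ℤ) ^ n.choose 2 else 0 := by
    intro y hy
    have h3 := Finset.prod_univ_sum (fun _ : IndexPair n => (Finset.univ : Finset (Fin 4)))
      (fun p k => pairProducts y p ^ (k : ℕ))
    rw [Fintype.piFinset_univ] at h3
    rw [← h3]
    split_ifs with h
    · rw [h]; simp [pairProducts, card_indexPair]
    · obtain ⟨p, hp⟩ := Function.ne_iff.mp h
      refine Finset.prod_eq_zero (Finset.mem_univ p) ?_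
      have : pairProducts y p = -1 := by
        simp only [pairProducts] at hp ⊢
        rcases mem_signVectors.mp hy p.1.1 with h2 | h2 <;>
        rcases mem_signVectors.mp hy p.1.2 with h3 | h3 <;> simp [h2, h3] at hp ⊢
      -- The factor is `1 - 1 + 1 - 1 = 0`.
      rw [this]; decide
  rw [Finset.sum_comm, Finset.sum_congr rfl h2, ← Finset.sum_filter, Finset.sum_const,
    card_fiber_pairProducts hn (mem_signVectors.mpr fun _ => .inr rfl)] at h1
  have h4 : ((2 * 4 ^ n.choose 2 : ℕ) : ℤ) = (((Finset.univ.filter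
      fun a : IndexPair n → Fin 4 => IsEvenWeight a).card * 2 ^ n : ℕ) : ℤ) := by
    push_cast; rw [← h1]; simp
  exact (Nat.cast_injective h4).symm

/-- Changing signs preserves `∑ a_p y_i y_j` modulo `4` when `a` has even degrees. -/
theorem IsEvenWeight.exists_sum_eq {n : ℕ} {a : IndexPair n → Fin 4} (ha : IsEvenWeight a)
    {y : Fin n → ℤ} (hy : y ∈ signVectors n) :
    ∃ c : ℤ, ∑ p, ((a p : ℕ) : ℤ) * pairProducts y p = ∑ p, ((a p : ℕ) : ℤ) + 4 * c := by
  have hb : ∀ k, ∃ b : ℤ, y k = 1 - 2 * b := fun k => by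
    rcases mem_signVectors.mp hy k with h | h
    · exact ⟨1, by rw [h]; norm_num⟩
    · exact ⟨0, by rw [h]; norm_num⟩
  choose b hb using hb
  choose c hc using ha
  -- With `y k = 1 - 2 b k`, `y_i y_j = 1 - 2 (b_i + b_j) + 4 b_i b_j`; the middle terms add up to
  -- `-2 ∑ deg k * b k`, a multiple of 4 since degrees are even.
  refine ⟨∑ p : IndexPair n, ((a p : ℕ) : ℤ) * (b p.1.1 * b p.1.2) - ∑ k, (c k : ℤ) * b k, ?_⟩
  have h1 := sum_vertexDegree_mul a b
  have h2 : ∑ k, (vertexDegree a k : ℤ) * b k = 2 * ∑ k, (c k : ℤ) * b k := by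
    rw [Finset.mul_sum]
    exact Finset.sum_congr rfl fun k _ => by rw [hc k]; push_cast; ring
  have h3 : ∑ p, ((a p : ℕ) : ℤ) * pairProducts y p = ∑ p, ((a p : ℕ) : ℤ) +
      4 * ∑ p : IndexPair n, ((a p : ℕ) : ℤ) * (b p.1.1 * b p.1.2) -
      2 * ∑ p : IndexPair n, ((a p : ℕ) : ℤ) * (b p.1.1 + b p.1.2) := by
    rw [Finset.mul_sum, Finset.mul_sum, ← Finset.sum_add_distrib, ← Finset.sum_sub_distrib]
    refine Finset.sum_congr rfl fun p _ => ?_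
    rw [pairProducts, hb p.1.1, hb p.1.2]; ring
  rw [h3, ← h1, h2]; ring

end Combinatorics

/-! ### Symmetry and decay of the characteristic function. -/

section CharacteristicFunction

/-- The characteristic function of an increment of the walk. -/
noncomputable def incrementCharFun (n : ℕ) (l : IndexPair n → ℝ) : ℂ :=
  (∑ y ∈ signVectors n, character l (pairProducts y)) / 2 ^ n

theorem continuous_incrementCharFun (n : ℕ) : Continuous (incrementCharFun n) := by
  unfold incrementCharFun
  exact (continuous_finsetSum _ fun y _ => continuous_character _).div_const _

theorem norm_incrementCharFun_le_one (n : ℕ) (l : IndexPair n → ℝ) :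
    ‖incrementCharFun n l‖ ≤ 1 := by
  rw [incrementCharFun, norm_div, norm_pow, Complex.norm_ofNat, div_le_one (by positivity)]
  refine (norm_sum_le _ _).trans ?_
  simp [norm_character, card_signVectors]

theorem character_quarterShift {ι : Type*} [Fintype ι] (a : ι → Fin 4) (u : ι → ℝ)
    (m : ι → ℤ) : character (quarterShift a u) m =
      character u m * Complex.I ^ (∑ p, ((a p : ℕ) : ℤ) * m p) := by
  have hI : Complex.I = Complex.exp (Real.pi / 2 * Complex.I) := by
    rw [Complex.exp_pi_div_two_mul_I]
  conv_rhs => rw [hI]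
  rw [← Complex.exp_int_mul, character, character, ← Complex.exp_add]
  congr 1
  simp only [quarterShift, add_mul, Finset.sum_add_distrib]
  push_cast
  simp only [add_mul, Finset.sum_mul]
  congr 1
  exact Finset.sum_congr rfl fun p _ => by ring

/-- Modulo 4 the exponent of `I` does not depend on `y`, so it factors out as a fourth root of
unity, which a power `4 * t` removes. -/
theorem IsEvenWeight.incrementCharFun_quarterShift_pow {n : ℕ} {a : IndexPair n → Fin 4}
    (ha : IsEvenWeight a) (u : IndexPair n → ℝ) (t : ℕ) :
    incrementCharFun n (quarterShift a u) ^ (4 * t) = incrementCharFun n u ^ (4 * t) := by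
  have h1 : incrementCharFun n (quarterShift a u) =
      incrementCharFun n u * Complex.I ^ (∑ p, ((a p : ℕ) : ℤ)) := by
    rw [incrementCharFun, incrementCharFun, div_mul_eq_mul_div, Finset.sum_mul]
    congr 1
    refine Finset.sum_congr rfl fun y hy => ?_
    obtain ⟨c, hc⟩ := ha.exists_sum_eq hy
    rw [character_quarterShift, hc, zpow_add₀ Complex.I_ne_zero, zpow_mul]
    have : Complex.I ^ (4 : ℤ) = 1 := by exact_mod_cast Complex.I_pow_four
    rw [this, one_zpow, mul_one]
  have h2 : (Complex.I ^ (∑ p, ((a p : ℕ) : ℤ))) ^ (4 * t) = 1 := by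
    rw [pow_mul, ← zpow_natCast (_ ^ _) 4, ← zpow_mul, mul_comm, zpow_mul]
    have : Complex.I ^ ((4 : ℕ) : ℤ) = 1 := by exact_mod_cast Complex.I_pow_four
    rw [this, one_zpow, one_pow]
  rw [h1, mul_pow, h2, mul_one]

theorem sum_signVectors_cos {n : ℕ} (θ : Fin n → ℝ) :
    ∑ y ∈ signVectors n, Real.cos (∑ j, θ j * (y j : ℝ)) = 2 ^ n * ∏ j, Real.cos (θ j) := by
  have h := sum_signVectors_prod (fun k (x : ℤ) => Complex.exp (((θ k * (x : ℝ) : ℝ) : ℂ) *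
    Complex.I))
  have h1 : ∀ y : Fin n → ℤ, ∏ k, Complex.exp (((θ k * (y k : ℝ) : ℝ) : ℂ) * Complex.I) =
      Complex.exp (((∑ j, θ j * (y j : ℝ) : ℝ) : ℂ) * Complex.I) := fun y => by
    rw [← Complex.exp_sum, ← Finset.sum_mul]; push_cast; rfl
  have h2 : ∀ k, Complex.exp (((θ k * ((-1 : ℤ) : ℝ) : ℝ) : ℂ) * Complex.I) +
      Complex.exp (((θ k * ((1 : ℤ) : ℝ) : ℝ) : ℂ) * Complex.I) =
      ((2 * Real.cos (θ k) : ℝ) : ℂ) := fun k => by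
    push_cast
    rw [Complex.cos]
    ring_nf
  simp only [h1, h2] at h
  rw [← Complex.ofReal_prod] at h
  have h3 := congrArg Complex.re h
  rw [Complex.re_sum, Complex.ofReal_re, Finset.prod_mul_distrib] at h3
  simp only [Complex.exp_ofReal_mul_I_re] at h3
  rw [h3]
  simp

/-- Negation of the coordinate `k`. -/
def flipSign {n : ℕ} (k : Fin n) (y : Fin n → ℤ) : Fin n → ℤ := Function.update y k (-y k)

theorem flipSign_flipSign {n : ℕ} (k : Fin n) (y : Fin n → ℤ) :
    flipSign k (flipSign k y) = y := by
  simp [flipSign]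

theorem flipSign_mem_signVectors {n : ℕ} (k : Fin n) {y : Fin n → ℤ}
    (hy : y ∈ signVectors n) : flipSign k y ∈ signVectors n := by
  rw [mem_signVectors] at hy ⊢
  intro j
  by_cases h : j = k
  · subst h
    rcases hy j with h1 | h1 <;> simp [flipSign, h1]
  · simpa [flipSign, h] using hy j

theorem sum_mul_pairProducts_flipSign {n : ℕ} (l : IndexPair n → ℝ) (k : Fin n)
    (y : Fin n → ℤ) : ∑ p, l p * (pairProducts (flipSign k y) p : ℝ) =
      ∑ p, l p * (pairProducts y p : ℝ) -
        2 * ((y k : ℝ) * ∑ j, symmExt l k j * (y j : ℝ)) := by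
  rw [sum_symmExt_mul, Finset.mul_sum, Finset.mul_sum, ← Finset.sum_sub_distrib]
  refine Finset.sum_congr rfl fun p _ => ?_
  have hne := p.2.ne
  by_cases h1 : p.1.1 = k
  · have h2 : p.1.2 ≠ k := fun h => hne (h1.trans h.symm)
    simp only [pairProducts, flipSign, h1, Function.update_self, Function.update_of_ne h2, h2]
    push_cast; simp; ring
  · by_cases h2 : p.1.2 = k
    · simp only [pairProducts, flipSign, h2, Function.update_self, Function.update_of_ne h1, h1]
      push_cast; simp; ring
    · simp [pairProducts, flipSign, h1, h2]

theorem norm_exp_add_exp_sub (θ s : ℝ) :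
    ‖Complex.exp ((θ : ℂ) * Complex.I) + Complex.exp (((θ - 2 * s : ℝ) : ℂ) * Complex.I)‖ =
      2 * |Real.cos s| := by
  have : Complex.exp ((θ : ℂ) * Complex.I) + Complex.exp (((θ - 2 * s : ℝ) : ℂ) * Complex.I) =
      Complex.exp (((θ - s : ℝ) : ℂ) * Complex.I) * ((2 * Real.cos s : ℝ) : ℂ) := by
    push_cast
    rw [Complex.cos, mul_div_cancel₀ _ two_ne_zero, mul_add, ← Complex.exp_add,
      ← Complex.exp_add]
    ring_nf
  rw [this, norm_mul, Complex.norm_exp_ofReal_mul_I, one_mul, Complex.norm_real, Real.norm_eq_abs,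
    abs_mul, abs_two]

/-- Pairing `y` with its flip at `k` turns two exponentials into `2 |cos (S y)|`. Cauchy–Schwarz and
`cos² s = (1 + cos 2s) / 2` then leave an average of cosines that factors over vertices. -/
theorem norm_incrementCharFun_sq_le {n : ℕ} (l : IndexPair n → ℝ) (k : Fin n) :
    ‖incrementCharFun n l‖ ^ 2 ≤ (1 + ∏ j, Real.cos (2 * symmExt l k j)) / 2 := by
  set S : (Fin n → ℤ) → ℝ := fun y => ∑ j, symmExt l k j * (y j : ℝ) with hS
  set D : ℂ := ∑ y ∈ signVectors n, character l (pairProducts y) with hD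
  have hflip : D = ∑ y ∈ signVectors n, character l (pairProducts (flipSign k y)) :=
    Finset.sum_nbij' (flipSign k) (flipSign k) (fun y hy => flipSign_mem_signVectors k hy)
      (fun y hy => flipSign_mem_signVectors k hy) (fun y _ => flipSign_flipSign k y)
      (fun y _ => flipSign_flipSign k y) (fun y _ => by rw [flipSign_flipSign])
  have h1 : ‖D‖ ≤ ∑ y ∈ signVectors n, |Real.cos (S y)| := by
    have h2 : (2 : ℂ) * D = ∑ y ∈ signVectors n,
        (character l (pairProducts y) + character l (pairProducts (flipSign k y))) := by
      rw [Finset.sum_add_distrib, ← hflip, two_mul]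
    have h3 : 2 * ‖D‖ ≤ ∑ y ∈ signVectors n, 2 * |Real.cos (S y)| := by
      rw [show 2 * ‖D‖ = ‖(2 : ℂ) * D‖ by simp, h2]
      refine (norm_sum_le _ _).trans (Finset.sum_le_sum fun y hy => le_of_eq ?_)
      rw [character, character, sum_mul_pairProducts_flipSign, norm_exp_add_exp_sub]
      -- The factor `y k = ±1` disappears because cosine is even.
      rcases mem_signVectors.mp hy k with h | h <;> simp [h, hS]
    rw [← Finset.mul_sum] at h3
    linarith
  have h4 : ‖D‖ ^ 2 ≤ 2 ^ n * ∑ y ∈ signVectors n, |Real.cos (S y)| ^ 2 := by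
    refine (pow_le_pow_left₀ (norm_nonneg _) h1 2).trans ?_
    refine sq_sum_le_card_mul_sum_sq.trans_eq ?_
    rw [card_signVectors]; push_cast; rfl
  have h5 : ∑ y ∈ signVectors n, |Real.cos (S y)| ^ 2 =
      (2 ^ n + 2 ^ n * ∏ j, Real.cos (2 * symmExt l k j)) / 2 := by
    rw [← sum_signVectors_cos]
    have : (2 ^ n : ℝ) = ∑ y ∈ signVectors n, (1 : ℝ) := by simp [card_signVectors]
    rw [this, ← Finset.sum_add_distrib, Finset.sum_div]
    refine Finset.sum_congr rfl fun y _ => ?_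
    rw [sq_abs, Real.cos_sq, hS, Finset.mul_sum]
    simp only [mul_assoc]
    ring
  rw [h5] at h4
  rw [incrementCharFun, norm_div, norm_pow, Complex.norm_ofNat, div_pow,
    div_le_iff₀ (by positivity)]
  refine h4.trans_eq ?_
  ring

theorem abs_two_mul_symmExt_le {n : ℕ} {u : IndexPair n → ℝ}
    (hu : u ∈ quarterCube (IndexPair n)) (k j : Fin n) :
    |2 * symmExt u k j| ≤ Real.pi / 2 := by
  have hpi := Real.pi_pos
  rcases symmExt_eq_zero_or u k j with h | ⟨p, h⟩
  · rw [h]; simp; positivity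
  · have := hu p (Set.mem_univ p)
    rw [h, abs_le]
    constructor <;> linarith [this.1, this.2]

theorem prod_cos_symmExt_nonneg {n : ℕ} {u : IndexPair n → ℝ}
    (hu : u ∈ quarterCube (IndexPair n)) (k : Fin n) :
    0 ≤ ∏ j, Real.cos (2 * symmExt u k j) :=
  Finset.prod_nonneg fun j _ =>
    Real.cos_nonneg_of_mem_Icc (abs_le.mp (abs_two_mul_symmExt_le hu k j))

/-- In the product at the vertex `p.1.1`, all cosines lie in `[0, 1]` on the cube; keeping only the
one for `p` gives `(1 + cos 2u) / 2 = cos² u`. -/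
theorem norm_incrementCharFun_le_cos {n : ℕ} {u : IndexPair n → ℝ}
    (hu : u ∈ quarterCube (IndexPair n)) (p : IndexPair n) :
    ‖incrementCharFun n u‖ ≤ Real.cos (u p) := by
  have hpi := Real.pi_pos
  have hp := hu p (Set.mem_univ p)
  have hc : ∀ j, 0 ≤ Real.cos (2 * symmExt u p.1.1 j) := fun j =>
    Real.cos_nonneg_of_mem_Icc (abs_le.mp (abs_two_mul_symmExt_le hu p.1.1 j))
  have h1 : ∏ j, Real.cos (2 * symmExt u p.1.1 j) ≤ Real.cos (2 * u p) := by
    rw [← Finset.mul_prod_erase _ _ (Finset.mem_univ p.1.2), symmExt_pair]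
    refine mul_le_of_le_one_right ?_
      (Finset.prod_le_one (fun j _ => hc j) fun j _ => Real.cos_le_one _)
    have := hc p.1.2
    rwa [symmExt_pair] at this
  refine le_of_sq_le_sq ?_ (Real.cos_nonneg_of_mem_Icc ⟨by linarith [hp.1], by linarith [hp.2]⟩)
  refine (norm_incrementCharFun_sq_le u p.1.1).trans ?_
  rw [Real.cos_sq]
  linarith

theorem norm_incrementCharFun_le_exp {n : ℕ} {u : IndexPair n → ℝ}
    (hu : u ∈ quarterCube (IndexPair n)) (p : IndexPair n) :
    ‖incrementCharFun n u‖ ≤ Real.exp (-(2 / Real.pi ^ 2 * u p ^ 2)) := by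
  have hpi := Real.pi_pos
  have hp := hu p (Set.mem_univ p)
  refine (norm_incrementCharFun_le_cos hu p).trans ((Real.cos_le_one_sub_mul_cos_sq
    (abs_le.mpr ⟨by linarith [hp.1], by linarith [hp.2]⟩)).trans ?_)
  linarith [Real.add_one_le_exp (-(2 / Real.pi ^ 2 * u p ^ 2))]

/-- At a vertex of odd degree the shift moves the doubled angles by multiples of `π` whose total
parity is odd, so the nonnegative cosine product changes sign. -/
theorem norm_incrementCharFun_quarterShift_pow_le {n : ℕ} {a : IndexPair n → Fin 4}
    (ha : ¬ IsEvenWeight a) {u : IndexPair n → ℝ} (hu : u ∈ quarterCube (IndexPair n)) (t : ℕ) :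
    ‖incrementCharFun n (quarterShift a u) ^ (4 * t)‖ ≤ (1 / 4) ^ t := by
  simp only [IsEvenWeight, not_forall, Nat.not_even_iff_odd] at ha
  obtain ⟨k, hk⟩ := ha
  have h1 : ∏ j, Real.cos (2 * symmExt (quarterShift a u) k j) =
      -∏ j, Real.cos (2 * symmExt u k j) := by
    have : ∀ j, Real.cos (2 * symmExt (quarterShift a u) k j) =
        (-1) ^ symmExt (fun p => (a p : ℕ)) k j * Real.cos (2 * symmExt u k j) := fun j => by
      rw [symmExt_quarterShift, mul_add,
        show 2 * (((symmExt (fun p => (a p : ℕ)) k j : ℕ) : ℝ) * (Real.pi / 2)) =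
          ((symmExt (fun p => (a p : ℕ)) k j : ℕ) : ℝ) * Real.pi by ring, Real.cos_add_nat_mul_pi]
    rw [Finset.prod_congr rfl fun j _ => this j, Finset.prod_mul_distrib,
      Finset.prod_pow_eq_pow_sum, sum_symmExt_eq_vertexDegree, hk.neg_one_pow, neg_one_mul]
  have h2 : ‖incrementCharFun n (quarterShift a u)‖ ^ 2 ≤ 1 / 2 := by
    have := norm_incrementCharFun_sq_le (quarterShift a u) k
    rw [h1] at this
    linarith [prod_cos_symmExt_nonneg hu k]
  rw [norm_pow, pow_mul]
  refine pow_le_pow_left₀ (by positivity) ?_ t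
  calc ‖incrementCharFun n (quarterShift a u)‖ ^ 4
      = (‖incrementCharFun n (quarterShift a u)‖ ^ 2) ^ 2 := by ring
    _ ≤ (1 / 2) ^ 2 := pow_le_pow_left₀ (by positivity) h2 2
    _ = 1 / 4 := by norm_num

end CharacteristicFunction

/-! ### Fourier inversion for the walk and for the matrix count. -/

section Inversion

open MeasureTheory

theorem continuous_sum_quarterShift {ι : Type*} [Fintype ι] [DecidableEq ι]
    {g : (ι → ℝ) → ℂ} (hg : Continuous g) :
    Continuous fun u => ∑ a : ι → Fin 4, g (quarterShift a u) :=
  continuous_finsetSum _ fun a _ => hg.comp (continuous_quarterShift a)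

theorem integrableOn_quarterCube {ι : Type*} [Fintype ι] {g : (ι → ℝ) → ℂ}
    (hg : Continuous g) : IntegrableOn g (quarterCube ι) :=
  hg.continuousOn.integrableOn_compact (isCompact_quarterCube ι)

/-- Integration over the fundamental domain of `(2πℤ)^ι` commutes with finite linear
combinations of continuous functions. -/
theorem integral_quarter_translates_sum {ι κ : Type*} [Fintype ι] [DecidableEq ι] (s : Finset κ)
    (g : κ → (ι → ℝ) → ℂ) (hg : ∀ y ∈ s, Continuous (g y)) :
    ∫ u in quarterCube ι, ∑ a : ι → Fin 4, ∑ y ∈ s, g y (quarterShift a u) =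
      ∑ y ∈ s, ∫ u in quarterCube ι, ∑ a : ι → Fin 4, g y (quarterShift a u) := by
  rw [← integral_finsetSum _ fun y hy =>
    integrableOn_quarterCube (continuous_sum_quarterShift (hg y hy))]
  exact integral_congr_ae (.of_forall fun u => Finset.sum_comm)

/-- Each increment comes from exactly two sign vectors, so averaging over increments is averaging
over sign vectors. -/
theorem toReal_walkLaw_succ {n : ℕ} (hn : 1 ≤ n) (t : ℕ) (z : IndexPair n → ℤ) :
    (walkLaw n 0 (t + 1) z).toReal =
      (∑ y ∈ signVectors n, (walkLaw n 0 t (z - pairProducts y)).toReal) / 2 ^ n := by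
  have h1 : walkLaw n 0 (t + 1) z =
      ∑ m ∈ increments n, walkLaw n 0 t (z - m) * ((increments n).card : ENNReal)⁻¹ := by
    rw [walkLaw, PMF.bind_apply]
    rw [← (Equiv.subLeft z).tsum_eq, tsum_eq_sum (s := increments n)]
    · refine Finset.sum_congr rfl fun m hm => ?_
      congr 1
      rw [PMF.map_apply, tsum_eq_single m]
      · simp [hm]
      · intro m' hm'
        refine if_neg fun h => hm' ?_
        simpa [sub_add_eq_add_sub, eq_sub_iff_add_eq, eq_comm] using h
    · intro m hm
      refine mul_eq_zero_of_right _ ?_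
      rw [PMF.map_apply, ENNReal.tsum_eq_zero]
      intro m'
      split_ifs with h
      · have : m' = m := by
          simpa [sub_add_eq_add_sub, eq_sub_iff_add_eq, eq_comm] using h
        rw [this, PMF.uniformOfFinset_apply_of_notMem _ hm]
      · rfl
  have hc := two_mul_card_increments hn
  have hc' : (2 : ℝ) * (increments n).card = 2 ^ n := by exact_mod_cast hc
  have hpos : ((increments n).card : ℝ) ≠ 0 :=
    Nat.cast_ne_zero.mpr (Finset.card_ne_zero.mpr (increments_nonempty n))
  rw [h1, ENNReal.toReal_sum fun m _ => ENNReal.mul_ne_top (PMF.apply_ne_top _ _)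
    (ENNReal.inv_ne_top.mpr (Nat.cast_ne_zero.mpr
      (Finset.card_ne_zero.mpr (increments_nonempty n))))]
  simp only [ENNReal.toReal_mul, ENNReal.toReal_inv, ENNReal.toReal_natCast]
  rw [sum_signVectors_comp_pairProducts hn (fun m => (walkLaw n 0 t (z - m)).toReal), ← hc',
    ← Finset.sum_mul]
  field_simp

/-- Induction on `t`, with `z` general because the last step moves the target to `z - pairProducts
y`. -/
theorem walkLaw_fourier_inversion {n : ℕ} (hn : 1 ≤ n) (t : ℕ) (z : IndexPair n → ℤ) :
    (((walkLaw n 0 t z).toReal * (2 * Real.pi) ^ n.choose 2 : ℝ) : ℂ) =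
      ∫ u in quarterCube (IndexPair n), ∑ a : IndexPair n → Fin 4,
        incrementCharFun n (quarterShift a u) ^ t * character (quarterShift a u) (-z) := by
  induction t generalizing z with
  | zero =>
    simp only [pow_zero, one_mul]
    rw [integral_quarter_translates_character, card_indexPair, walkLaw, PMF.pure_apply]
    by_cases h : z = 0 <;> simp [h]
  | succ t ih =>
    have h1 : ∀ u (a : IndexPair n → Fin 4),
        incrementCharFun n (quarterShift a u) ^ (t + 1) * character (quarterShift a u) (-z) =
        ∑ y ∈ signVectors n, (incrementCharFun n (quarterShift a u) ^ t *
          character (quarterShift a u) (-(z - pairProducts y))) / 2 ^ n := fun u a => by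
      rw [pow_succ]
      nth_rw 2 [incrementCharFun]
      rw [← Finset.sum_div, mul_div_assoc', div_mul_eq_mul_div, Finset.mul_sum, Finset.sum_mul]
      congr 1
      refine Finset.sum_congr rfl fun y _ => ?_
      rw [neg_sub, sub_eq_add_neg, character_add, mul_assoc]
    simp only [h1]
    rw [integral_quarter_translates_sum (signVectors n)
      (fun y l => (incrementCharFun n l ^ t * character l (-(z - pairProducts y))) / 2 ^ n)
      fun y _ => (((continuous_incrementCharFun n).pow t).mul
        (continuous_character _)).div_const _]
    simp only [← Finset.sum_div, integral_div, ← ih]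
    rw [toReal_walkLaw_succ hn]
    push_cast
    rw [← Finset.sum_mul]
    ring

theorem numPartialHadamard_eq_card (n t : ℕ) : numPartialHadamard n t =
    ((Fintype.piFinset fun _ : Fin t => signVectors n).filter
      fun f => ∑ k, pairProducts (f k) = 0).card := by
  rw [numPartialHadamard, ← Set.ncard_coe_finset]
  refine Set.ncard_congr (fun A _ => A.transpose) ?_ (fun A B _ _ h => Matrix.transpose_injective h)
    ?_
  · intro A hA
    simp only [Finset.coe_filter, Fintype.mem_piFinset, mem_signVectors]
    refine ⟨fun k i => (hA.1 i k).symm, funext fun p => ?_⟩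
    have := hA.2 p.1.1 p.1.2 p.2.ne
    simpa [dotProduct, pairProducts, Finset.sum_apply] using this
  · intro f hf
    simp only [Finset.coe_filter, Set.mem_ofPred_eq, Fintype.mem_piFinset, mem_signVectors] at hf
    refine ⟨Matrix.transpose f, ⟨fun i k => (hf.1 k i).symm, fun i j hij => ?_⟩,
      Matrix.transpose_transpose f⟩
    rcases lt_or_gt_of_ne hij with h | h
    · have := congrFun hf.2 ⟨(i, j), h⟩
      simpa [dotProduct, pairProducts, Finset.sum_apply, Matrix.transpose] using this
    · have := congrFun hf.2 ⟨(j, i), h⟩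
      rw [dotProduct_comm]
      simpa [dotProduct, pairProducts, Finset.sum_apply, Matrix.transpose] using this

theorem character_sum {ι κ : Type*} [Fintype ι] (l : ι → ℝ) (s : Finset κ) (f : κ → ι → ℤ) :
    character l (∑ k ∈ s, f k) = ∏ k ∈ s, character l (f k) := by
  classical
  induction s using Finset.induction_on with
  | empty => simp [character]
  | insert k s hk ih => rw [Finset.sum_insert hk, Finset.prod_insert hk, character_add, ih]

theorem two_pow_mul_incrementCharFun_pow (n t : ℕ) (l : IndexPair n → ℝ) :
    (2 : ℂ) ^ (n * t) * incrementCharFun n l ^ t =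
      ∑ f ∈ Fintype.piFinset fun _ : Fin t => signVectors n,
        character l (∑ k, pairProducts (f k)) := by
  have h3 := Finset.prod_univ_sum (fun _ : Fin t => signVectors n)
    (fun _ y => character l (pairProducts y))
  simp only [character_sum]
  rw [← h3, Finset.prod_const, Finset.card_univ, Fintype.card_fin, pow_mul, ← mul_pow,
    incrementCharFun, mul_div_cancel₀ _ (pow_ne_zero n two_ne_zero)]

theorem numPartialHadamard_fourier_inversion (n t : ℕ) :
    (((numPartialHadamard n t : ℝ) * (2 * Real.pi) ^ n.choose 2 : ℝ) : ℂ) =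
      (2 : ℂ) ^ (n * t) * ∫ u in quarterCube (IndexPair n), ∑ a : IndexPair n → Fin 4,
        incrementCharFun n (quarterShift a u) ^ t := by
  rw [← integral_const_mul]
  simp only [Finset.mul_sum, two_pow_mul_incrementCharFun_pow]
  have hc : ∀ f ∈ Fintype.piFinset fun _ : Fin t => signVectors n,
      Continuous fun l : IndexPair n → ℝ => character l (∑ k, pairProducts (f k)) :=
    fun f _ => continuous_character (∑ k, pairProducts (f k))
  rw [integral_quarter_translates_sum (Fintype.piFinset fun _ : Fin t => signVectors n)
    (fun f l => character l (∑ k, pairProducts (f k))) hc]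
  simp only [integral_quarter_translates_character, card_indexPair]
  rw [← Finset.sum_filter, Finset.sum_const, numPartialHadamard_eq_card, nsmul_eq_mul,
    Complex.ofReal_mul, Complex.ofReal_natCast]

/-- Both sides are read off from the same Fourier integral. -/
theorem numPartialHadamard_eq_transitionProb {n : ℕ} (hn : 1 ≤ n) (t : ℕ) :
    (numPartialHadamard n t : ℝ) = 2 ^ (n * t) * transitionProb n t 0 0 := by
  have h1 := numPartialHadamard_fourier_inversion n t
  have h2 := walkLaw_fourier_inversion hn t 0
  have h3 : ∀ l : IndexPair n → ℝ, character l (-0) = 1 := fun l => by simp [character]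
  simp only [h3, mul_one] at h2
  rw [← h2] at h1
  have h4 : (numPartialHadamard n t : ℝ) * (2 * Real.pi) ^ n.choose 2 =
      2 ^ (n * t) * ((walkLaw n 0 t 0).toReal * (2 * Real.pi) ^ n.choose 2) := by
    exact_mod_cast h1
  rw [← mul_assoc] at h4
  exact mul_right_cancel₀ (by positivity) h4

end Inversion

/-! ### Gaussian limit on each translate and assembly of constants. -/

section LocalLimit

open MeasureTheory Topology

theorem pairProducts_flipSign {n : ℕ} (k : Fin n) (y : Fin n → ℤ) (p : IndexPair n) :
    pairProducts (flipSign k y) p =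
      if p.1.1 = k ∨ p.1.2 = k then -pairProducts y p else pairProducts y p := by
  have hne := p.2.ne
  by_cases h1 : p.1.1 = k
  · have h2 : p.1.2 ≠ k := fun h => hne (h1.trans h.symm)
    simp [pairProducts, flipSign, h1, h2]
  · by_cases h2 : p.1.2 = k <;> simp [pairProducts, flipSign, h1, h2]

theorem sum_signVectors_eq_zero_of_flipSign {n : ℕ} (k : Fin n) (f : (Fin n → ℤ) → ℤ)
    (hf : ∀ y, f (flipSign k y) = -f y) : ∑ y ∈ signVectors n, f y = 0 := by
  have h : ∑ y ∈ signVectors n, f y = ∑ y ∈ signVectors n, f (flipSign k y) :=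
    Finset.sum_nbij' (flipSign k) (flipSign k) (fun y hy => flipSign_mem_signVectors k hy)
      (fun y hy => flipSign_mem_signVectors k hy) (fun y _ => flipSign_flipSign k y)
      (fun y _ => flipSign_flipSign k y) (fun y _ => by rw [flipSign_flipSign])
  simp only [hf, Finset.sum_neg_distrib] at h
  omega

theorem sum_signVectors_pairProducts {n : ℕ} (p : IndexPair n) :
    ∑ y ∈ signVectors n, pairProducts y p = 0 :=
  sum_signVectors_eq_zero_of_flipSign p.1.1 _ fun y => by simp [pairProducts_flipSign]

/-- Distinct pairs are uncorrelated: `p` has an endpoint outside `q`, and flipping the sign there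
negates the product. -/
theorem sum_signVectors_pairProducts_mul {n : ℕ} (p q : IndexPair n) :
    ∑ y ∈ signVectors n, pairProducts y p * pairProducts y q = if p = q then 2 ^ n else 0 := by
  split_ifs with h
  · subst h
    rw [Finset.sum_congr rfl fun y hy => show pairProducts y p * pairProducts y p = 1 by
      rw [pairProducts, mul_mul_mul_comm, mul_self_of_mem_signVectors hy,
        mul_self_of_mem_signVectors hy, one_mul]]
    simp [card_signVectors]
  · by_cases h1 : q.1.1 = p.1.1 ∨ q.1.2 = p.1.1
    · have h2 : ¬ (q.1.1 = p.1.2 ∨ q.1.2 = p.1.2) := by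
        have hp := p.2
        have hq := q.2
        rintro (h2 | h2) <;> rcases h1 with h1 | h1
        · exact hp.ne (h1.symm.trans h2)
        · rw [h1, h2] at hq; exact lt_asymm hp hq
        · exact h (Subtype.ext (Prod.ext h1.symm h2.symm))
        · exact hp.ne (h1.symm.trans h2)
      exact sum_signVectors_eq_zero_of_flipSign p.1.2 _ fun y => by
        rw [pairProducts_flipSign, pairProducts_flipSign, if_pos (.inr rfl), if_neg h2, neg_mul]
    · exact sum_signVectors_eq_zero_of_flipSign p.1.1 _ fun y => by
        rw [pairProducts_flipSign, pairProducts_flipSign, if_pos (.inl rfl), if_neg h1, neg_mul]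

theorem sum_signVectors_linear {n : ℕ} (v : IndexPair n → ℝ) :
    ∑ y ∈ signVectors n, ∑ p, v p * (pairProducts y p : ℝ) = 0 := by
  rw [Finset.sum_comm]
  refine Finset.sum_eq_zero fun p _ => ?_
  rw [← Finset.mul_sum, ← Int.cast_sum, sum_signVectors_pairProducts, Int.cast_zero, mul_zero]

theorem sum_signVectors_linear_sq {n : ℕ} (v : IndexPair n → ℝ) :
    ∑ y ∈ signVectors n, (∑ p, v p * (pairProducts y p : ℝ)) ^ 2 = 2 ^ n * ∑ p, v p ^ 2 := by
  simp only [sq, Finset.sum_mul_sum]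
  rw [Finset.sum_comm, Finset.mul_sum]
  refine Finset.sum_congr rfl fun p _ => ?_
  rw [Finset.sum_comm]
  have h1 : ∀ q, ∑ y ∈ signVectors n,
      v p * (pairProducts y p : ℝ) * (v q * (pairProducts y q : ℝ)) =
      if p = q then v p * v q * 2 ^ n else 0 := fun q => by
    have h2 : ∀ y ∈ signVectors n,
        v p * (pairProducts y p : ℝ) * (v q * (pairProducts y q : ℝ)) =
        v p * v q * ((pairProducts y p * pairProducts y q : ℤ) : ℝ) := fun y _ => by
      push_cast; ring
    rw [Finset.sum_congr rfl h2, ← Finset.mul_sum, ← Int.cast_sum,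
      sum_signVectors_pairProducts_mul]
    split_ifs <;> simp
  simp only [h1, Finset.sum_ite_eq, Finset.mem_univ, if_true]
  ring

theorem tendsto_inv_sqrt_natCast : Tendsto (fun t : ℕ => (√(t : ℝ))⁻¹) atTop (𝓝 0) :=
  (Real.tendsto_sqrt_atTop.comp tendsto_natCast_atTop_atTop).inv_tendsto_atTop

/-- Second-order Taylor expansion: the cubic remainder, times `t`, is at most `|w|³ / √t`. -/
theorem tendsto_mul_exp_sub_one_sub (w : ℝ) :
    Tendsto (fun t : ℕ => (t : ℂ) * (Complex.exp ((((√(t : ℝ))⁻¹ * w : ℝ) : ℂ) * Complex.I) - 1 -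
      (((√(t : ℝ))⁻¹ * w : ℝ) : ℂ) * Complex.I)) atTop (𝓝 (-(w : ℂ) ^ 2 / 2)) := by
  rw [tendsto_iff_norm_sub_tendsto_zero]
  have hlim : Tendsto (fun t : ℕ => |w| ^ 3 * (√(t : ℝ))⁻¹) atTop (𝓝 0) := by
    simpa using tendsto_inv_sqrt_natCast.const_mul (|w| ^ 3)
  have hsmall : ∀ᶠ t : ℕ in atTop, |(√(t : ℝ))⁻¹ * w| ≤ 1 := by
    have h1 : Tendsto (fun t : ℕ => |(√(t : ℝ))⁻¹ * w|) atTop (𝓝 0) := by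
      simpa using (tendsto_inv_sqrt_natCast.mul_const w).abs
    exact h1.eventually_le_const zero_lt_one
  refine squeeze_zero' (.of_forall fun _ => norm_nonneg _) ?_ hlim
  filter_upwards [hsmall, eventually_gt_atTop 0] with t ht ht0
  have ht0' : (0 : ℝ) < t := Nat.cast_pos.mpr ht0
  set s : ℝ := (√(t : ℝ))⁻¹ with hs
  have hs0 : 0 < s := inv_pos.mpr (Real.sqrt_pos.mpr ht0')
  have hts : (t : ℝ) * s ^ 2 = 1 := by
    rw [hs, inv_pow, Real.sq_sqrt ht0'.le, mul_inv_cancel₀ ht0'.ne']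
  have hts' : (t : ℂ) * (s : ℂ) ^ 2 = 1 := by exact_mod_cast hts
  set z : ℂ := ((s * w : ℝ) : ℂ) * Complex.I with hz
  have hnz : ‖z‖ = s * |w| := by
    rw [hz, norm_mul, Complex.norm_I, mul_one, Complex.norm_real, Real.norm_eq_abs, abs_mul,
      abs_of_pos hs0]
  have hz1 : ‖z‖ ≤ 1 := by
    rw [hnz]; rwa [abs_mul, abs_of_pos hs0] at ht
  have hb := Complex.exp_bound hz1 (n := 3) (by norm_num)
  have hz2 : (t : ℂ) * z ^ 2 = -(w : ℂ) ^ 2 := by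
    rw [hz]
    push_cast
    linear_combination (w : ℂ) ^ 2 * Complex.I ^ 2 * hts' + (w : ℂ) ^ 2 * Complex.I_sq
  have heq : (t : ℂ) * (Complex.exp z - 1 - z) - -(w : ℂ) ^ 2 / 2 =
      (t : ℂ) * (Complex.exp z - ∑ m ∈ Finset.range 3, z ^ m / (m.factorial : ℂ)) := by
    rw [← hz2]
    simp [Finset.sum_range_succ, Nat.factorial]
    ring
  rw [heq, norm_mul, Complex.norm_natCast]
  calc (t : ℝ) * ‖Complex.exp z - ∑ m ∈ Finset.range 3, z ^ m / (m.factorial : ℂ)‖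
      ≤ t * (‖z‖ ^ 3 * 1) := by
        refine mul_le_mul_of_nonneg_left (hb.trans ?_) ht0'.le
        refine mul_le_mul_of_nonneg_left ?_ (by positivity)
        -- The constant in `Complex.exp_bound` is `4 / (3! * 3) ≤ 1`.
        norm_num [Nat.factorial]
    _ = |w| ^ 3 * s := by
        rw [hnz]
        linear_combination |w| ^ 3 * s * hts

theorem character_smul {ι : Type*} [Fintype ι] (s : ℝ) (v : ι → ℝ) (m : ι → ℤ) :
    character (s • v) m =
      Complex.exp (((s * ∑ p, v p * (m p : ℝ) : ℝ) : ℂ) * Complex.I) := by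
  rw [character, Finset.mul_sum]
  simp only [Pi.smul_apply, smul_eq_mul, mul_assoc]

/-- Mean zero lets the linear terms be subtracted freely; the identity covariance evaluates the
quadratic ones. -/
theorem tendsto_mul_incrementCharFun_sub_one {n : ℕ} (v : IndexPair n → ℝ) :
    Tendsto (fun t : ℕ => (t : ℂ) * (incrementCharFun n ((√(t : ℝ))⁻¹ • v) - 1)) atTop
      (𝓝 ((-(∑ p, v p ^ 2) / 2 : ℝ) : ℂ)) := by
  set Q : (Fin n → ℤ) → ℝ := fun y => ∑ p, v p * (pairProducts y p : ℝ) with hQ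
  have h2n : (2 : ℂ) ^ n ≠ 0 := pow_ne_zero n two_ne_zero
  have h1 : ∀ t : ℕ, (t : ℂ) * (incrementCharFun n ((√(t : ℝ))⁻¹ • v) - 1) =
      (∑ y ∈ signVectors n, (t : ℂ) * (Complex.exp ((((√(t : ℝ))⁻¹ * Q y : ℝ) : ℂ) * Complex.I)
        - 1 - (((√(t : ℝ))⁻¹ * Q y : ℝ) : ℂ) * Complex.I)) / 2 ^ n := fun t => by
    have h0 : ∑ y ∈ signVectors n, (((√(t : ℝ))⁻¹ * Q y : ℝ) : ℂ) * Complex.I = 0 := by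
      rw [← Finset.sum_mul, ← Complex.ofReal_sum, ← Finset.mul_sum, sum_signVectors_linear]
      simp
    rw [← Finset.mul_sum, Finset.sum_sub_distrib, Finset.sum_sub_distrib, h0,
      Finset.sum_const, card_signVectors, incrementCharFun]
    rw [Finset.sum_congr rfl fun y _ => character_smul (√(t : ℝ))⁻¹ v (pairProducts y),
      nsmul_eq_mul]
    generalize ∑ y ∈ signVectors n, Complex.exp _ = E
    push_cast
    field_simp
    ring
  simp only [h1]
  have h3 : ((-(∑ p, v p ^ 2) / 2 : ℝ) : ℂ) =
      (∑ y ∈ signVectors n, -(Q y : ℂ) ^ 2 / 2) / 2 ^ n := by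
    have := sum_signVectors_linear_sq v
    have h4 : ∑ y ∈ signVectors n, (Q y : ℂ) ^ 2 = 2 ^ n * ((∑ p, v p ^ 2 : ℝ) : ℂ) := by
      exact_mod_cast this
    rw [← Finset.sum_div, Finset.sum_neg_distrib, h4]
    push_cast
    field_simp
  rw [h3]
  exact (tendsto_finsetSum _ fun y _ => tendsto_mul_exp_sub_one_sub (Q y)).div_const _

theorem tendsto_incrementCharFun_pow {n : ℕ} (v : IndexPair n → ℝ) :
    Tendsto (fun t : ℕ => incrementCharFun n ((√(t : ℝ))⁻¹ • v) ^ (4 * t)) atTop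
      (𝓝 ((∏ p, Real.exp (-2 * v p ^ 2) : ℝ) : ℂ)) := by
  have h := (Complex.tendsto_one_add_pow_exp_of_tendsto
    (tendsto_mul_incrementCharFun_sub_one v)).pow 4
  have h1 : Complex.exp ((-(∑ p, v p ^ 2) / 2 : ℝ) : ℂ) ^ 4 =
      ((∏ p, Real.exp (-2 * v p ^ 2) : ℝ) : ℂ) := by
    rw [← Complex.exp_nat_mul, ← Real.exp_sum, ← Finset.mul_sum, Complex.ofReal_exp]
    congr 1
    push_cast
    ring
  rw [h1] at h
  refine h.congr fun t => ?_
  rw [add_sub_cancel, ← pow_mul, mul_comm]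

theorem quarterCube_mem_nhds (ι : Type*) [Finite ι] : quarterCube ι ∈ 𝓝 (0 : ι → ℝ) :=
  set_pi_mem_nhds Set.finite_univ fun _ _ =>
    Icc_mem_nhds (by simp [Real.pi_pos]) (by simp [Real.pi_pos])

/-- Geometric mean of the one-coordinate bounds. The root taken is `d + 1` rather than `d`, harmless
since the norm is at most 1, so that `d = 0` is covered. -/
theorem norm_incrementCharFun_pow_le {n : ℕ} {u : IndexPair n → ℝ}
    (hu : u ∈ quarterCube (IndexPair n)) (N : ℕ) :
    ‖incrementCharFun n u ^ N‖ ≤ ∏ p, Real.exp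
      (-(2 * N / (Real.pi ^ 2 * (Fintype.card (IndexPair n) + 1))) * u p ^ 2) := by
  set d := Fintype.card (IndexPair n) with hd
  set B := ‖incrementCharFun n u ^ N‖ with hB
  have hB0 : 0 ≤ B := norm_nonneg _
  have hB1 : B ≤ 1 := by
    rw [hB, norm_pow]; exact pow_le_one₀ (norm_nonneg _) (norm_incrementCharFun_le_one n u)
  refine (pow_le_pow_iff_left₀ hB0 (by positivity) (Nat.succ_ne_zero d)).mp ?_
  calc B ^ (d + 1) ≤ B ^ d := pow_le_pow_of_le_one hB0 hB1 (Nat.le_succ d)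
    _ = ∏ p : IndexPair n, B := by rw [Finset.prod_const, Finset.card_univ]
    _ ≤ ∏ p, Real.exp (-(2 / Real.pi ^ 2 * u p ^ 2)) ^ N := by
        refine Finset.prod_le_prod (fun _ _ => hB0) fun p _ => ?_
        rw [hB, norm_pow]
        exact pow_le_pow_left₀ (norm_nonneg _) (norm_incrementCharFun_le_exp hu p) N
    _ = _ := by
        rw [← Finset.prod_pow]
        refine Finset.prod_congr rfl fun p _ => ?_
        rw [← Real.exp_nat_mul, ← Real.exp_nat_mul]
        congr 1
        have := Real.pi_pos
        push_cast
        field_simp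

theorem tendsto_integral_incrementCharFun_pow (n : ℕ) :
    Tendsto (fun t : ℕ => ((√(t : ℝ) ^ n.choose 2 : ℝ) : ℂ) *
      ∫ u in quarterCube (IndexPair n), incrementCharFun n u ^ (4 * t)) atTop
      (𝓝 ((√(Real.pi / 2) ^ n.choose 2 : ℝ) : ℂ)) := by
  set C := quarterCube (IndexPair n) with hC
  have hCm : MeasurableSet C := (isCompact_quarterCube _).measurableSet
  -- The rate of `norm_incrementCharFun_pow_le` at `N = 4 * t`, after `u p ^ 2 = v p ^ 2 / t`.
  set b : ℝ := 8 / (Real.pi ^ 2 * (Fintype.card (IndexPair n) + 1)) with hb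
  have hb0 : 0 < b := by have := Real.pi_pos; positivity
  set F : ℕ → (IndexPair n → ℝ) → ℂ := fun t v =>
    C.indicator (fun u => incrementCharFun n u ^ (4 * t)) ((√(t : ℝ))⁻¹ • v) with hF
  have hgauss : ∫ v : IndexPair n → ℝ, ((∏ p, Real.exp (-2 * v p ^ 2) : ℝ) : ℂ) =
      ((√(Real.pi / 2) ^ n.choose 2 : ℝ) : ℂ) := by
    rw [integral_complex_ofReal, integral_fintype_prod_volume_eq_prod
      (fun _ x => Real.exp (-2 * x ^ 2))]
    simp only [integral_gaussian, Finset.prod_const, Finset.card_univ, card_indexPair]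
  have hmain : Tendsto (fun t => ∫ v, F t v) atTop
      (𝓝 (∫ v : IndexPair n → ℝ, ((∏ p, Real.exp (-2 * v p ^ 2) : ℝ) : ℂ))) := by
    refine tendsto_integral_filter_of_dominated_convergence
      (fun v : IndexPair n → ℝ => ∏ p, Real.exp (-b * v p ^ 2)) ?_ ?_ ?_ ?_
    · refine .of_forall fun t => Measurable.aestronglyMeasurable ?_
      exact (((continuous_incrementCharFun n).pow (4 * t)).measurable.indicator hCm).comp
        (measurable_const_smul _)
    · filter_upwards [eventually_gt_atTop 0] with t ht
      refine .of_forall fun v => ?_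
      have ht0 : (0 : ℝ) < t := Nat.cast_pos.mpr ht
      by_cases hv : (√(t : ℝ))⁻¹ • v ∈ C
      · simp only [hF, Set.indicator_of_mem hv]
        refine (norm_incrementCharFun_pow_le hv _).trans_eq ?_
        refine Finset.prod_congr rfl fun p _ => ?_
        congr 1
        have h1 : ((√(t : ℝ))⁻¹ * v p) ^ 2 = v p ^ 2 / t := by
          rw [mul_pow, inv_pow, Real.sq_sqrt ht0.le]; field_simp
        rw [Pi.smul_apply, smul_eq_mul, h1, hb]
        have := Real.pi_pos
        push_cast
        field_simp
        ring
      · simp only [hF, Set.indicator_of_notMem hv, norm_zero]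
        positivity
    · rw [volume_pi]
      exact Integrable.fintype_prod fun _ => integrable_exp_neg_mul_sq hb0
    · refine .of_forall fun v => (tendsto_incrementCharFun_pow v).congr' ?_
      have h1 : Tendsto (fun t : ℕ => (√(t : ℝ))⁻¹ • v) atTop (𝓝 0) := by
        simpa using tendsto_inv_sqrt_natCast.smul_const v
      filter_upwards [h1 (quarterCube_mem_nhds _)] with t ht
      exact (Set.indicator_of_mem (s := C) (Set.mem_preimage.mp ht)
        fun u => incrementCharFun n u ^ (4 * t)).symm
  rw [hgauss] at hmain
  refine hmain.congr' ?_
  filter_upwards [eventually_gt_atTop 0] with t ht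
  have ht0 : (0 : ℝ) < t := Nat.cast_pos.mpr ht
  simp only [hF]
  rw [Measure.integral_comp_smul volume
    (C.indicator fun u => incrementCharFun n u ^ (4 * t)), integral_indicator hCm,
    Module.finrank_fintype_fun_eq_card, card_indexPair, inv_pow, inv_inv,
    abs_of_nonneg (by positivity), Complex.real_smul]

/-- The cube has finite volume and `(1 / 4) ^ t` beats any power of `t`, so the crude `√t ≤ t`
suffices. -/
theorem tendsto_integral_incrementCharFun_quarterShift_pow {n : ℕ} {a : IndexPair n → Fin 4}
    (ha : ¬ IsEvenWeight a) :
    Tendsto (fun t : ℕ => ((√(t : ℝ) ^ n.choose 2 : ℝ) : ℂ) *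
      ∫ u in quarterCube (IndexPair n), incrementCharFun n (quarterShift a u) ^ (4 * t)) atTop
      (𝓝 0) := by
  set V := volume.real (quarterCube (IndexPair n)) with hV
  have hlim : Tendsto (fun t : ℕ => (t : ℝ) ^ n.choose 2 * (1 / 4) ^ t * V) atTop (𝓝 0) := by
    simpa using (tendsto_pow_const_mul_const_pow_of_lt_one (n.choose 2)
      (by norm_num : (0 : ℝ) ≤ 1 / 4) (by norm_num)).mul_const V
  refine squeeze_zero_norm (fun t => ?_) hlim
  have h1 := norm_setIntegral_le_of_norm_le_const (μ := volume)
    (isCompact_quarterCube (IndexPair n)).measure_lt_top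
    (f := fun u => incrementCharFun n (quarterShift a u) ^ (4 * t))
    (fun u hu => norm_incrementCharFun_quarterShift_pow_le ha hu t)
  have h2 : √(t : ℝ) ≤ t := by
    rcases Nat.eq_zero_or_pos t with rfl | ht
    · simp
    · exact Real.sqrt_le_iff.mpr ⟨t.cast_nonneg, by exact_mod_cast Nat.le_self_pow two_ne_zero t⟩
  rw [norm_mul, Complex.norm_real, Real.norm_of_nonneg (by positivity), mul_assoc]
  exact mul_le_mul (pow_le_pow_left₀ (Real.sqrt_nonneg _) h2 _) h1 (norm_nonneg _) (by positivity)

open Classical in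
theorem tendsto_transitionProb {n : ℕ} (hn : 1 ≤ n) :
    Tendsto (fun t : ℕ => √(t : ℝ) ^ n.choose 2 *
      (transitionProb n (4 * t) 0 0 * (2 * Real.pi) ^ n.choose 2)) atTop
      (𝓝 ((Finset.univ.filter fun a : IndexPair n → Fin 4 => IsEvenWeight a).card *
        √(Real.pi / 2) ^ n.choose 2)) := by
  have h1 : ∀ a : IndexPair n → Fin 4, Tendsto (fun t : ℕ => ((√(t : ℝ) ^ n.choose 2 : ℝ) : ℂ) *
      ∫ u in quarterCube (IndexPair n), incrementCharFun n (quarterShift a u) ^ (4 * t)) atTop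
      (𝓝 (if IsEvenWeight a then ((√(Real.pi / 2) ^ n.choose 2 : ℝ) : ℂ) else 0)) := fun a => by
    split_ifs with ha
    · simp only [ha.incrementCharFun_quarterShift_pow]
      exact tendsto_integral_incrementCharFun_pow n
    · exact tendsto_integral_incrementCharFun_quarterShift_pow ha
  have h2 := tendsto_finsetSum Finset.univ fun a _ => h1 a
  rw [← Finset.sum_filter, Finset.sum_const, nsmul_eq_mul] at h2
  have h3 := (Complex.continuous_re.tendsto _).comp h2
  have h4 : ∀ t : ℕ, ∑ a : IndexPair n → Fin 4, ((√(t : ℝ) ^ n.choose 2 : ℝ) : ℂ) *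
      ∫ u in quarterCube (IndexPair n), incrementCharFun n (quarterShift a u) ^ (4 * t) =
      ((√(t : ℝ) ^ n.choose 2 *
        (transitionProb n (4 * t) 0 0 * (2 * Real.pi) ^ n.choose 2) : ℝ) : ℂ) := fun t => by
    have h5 := walkLaw_fourier_inversion hn (4 * t) 0
    have h6 : ∀ l : IndexPair n → ℝ, character l (-0) = 1 := fun l => by simp [character]
    simp only [h6, mul_one] at h5
    rw [integral_finsetSum (f := fun (a : IndexPair n → Fin 4) u =>
      incrementCharFun n (quarterShift a u) ^ (4 * t)) _ fun a _ => integrableOn_quarterCube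
      (((continuous_incrementCharFun n).comp (continuous_quarterShift a)).pow (4 * t))] at h5
    rw [← Finset.mul_sum, Complex.ofReal_mul, transitionProb, h5]
  simp only [h4] at h3
  rw [← Complex.ofReal_natCast, ← Complex.ofReal_mul, Complex.ofReal_re] at h3
  exact h3

theorem isEquivalent_transitionProb {n : ℕ} (hn : 1 ≤ n) :
    (fun t : ℕ => transitionProb n (4 * t) 0 0) ~[atTop]
      fun t : ℕ => (2 : ℝ) ^ (2 * (n.choose 2 : ℤ) - (n : ℤ) + 1) *
        (8 * Real.pi * (t : ℝ)) ^ (-(n.choose 2 : ℝ) / 2) := by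
  classical
  set d := n.choose 2 with hd
  set K : ℝ := (2 : ℝ) ^ (2 * (d : ℤ) - (n : ℤ) + 1) with hK
  have hK0 : K ≠ 0 := zpow_ne_zero _ two_ne_zero
  have hpi := Real.pi_pos
  have hcard : ((Finset.univ.filter fun a : IndexPair n → Fin 4 => IsEvenWeight a).card : ℝ) =
      K := by
    have h1 : ((Finset.univ.filter fun a : IndexPair n → Fin 4 => IsEvenWeight a).card : ℝ) *
        2 ^ n = 2 * 4 ^ d := by exact_mod_cast card_evenWeights_mul hn
    have h2 : K * 2 ^ n = 2 * 4 ^ d := by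
      rw [hK, ← zpow_natCast, ← zpow_add₀ two_ne_zero,
        show 2 * (d : ℤ) - n + 1 + n = 1 + 2 * (d : ℤ) by ring, zpow_add₀ two_ne_zero, zpow_mul,
        zpow_natCast]
      norm_num
    exact mul_right_cancel₀ (by positivity) (h1.trans h2.symm)
  have hlim := tendsto_transitionProb hn
  rw [hcard] at hlim
  -- This identity converts the Gaussian constant and the Fourier normalisation into `(8π)^(-d/2)`.
  have hconst : √(Real.pi / 2) * √(8 * Real.pi) = 2 * Real.pi := by
    rw [← Real.sqrt_mul (by positivity), show Real.pi / 2 * (8 * Real.pi) = (2 * Real.pi) ^ 2 by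
      ring, Real.sqrt_sq (by positivity)]
  refine isEquivalent_of_tendsto_one ?_
  have h3 := hlim.mul_const (√(8 * Real.pi) ^ d / (2 * Real.pi) ^ d / K)
  have h4 : K * √(Real.pi / 2) ^ d * (√(8 * Real.pi) ^ d / (2 * Real.pi) ^ d / K) = 1 := by
    rw [← hconst, mul_pow]
    have : √(Real.pi / 2) ≠ 0 := by positivity
    have : √(8 * Real.pi) ≠ 0 := by positivity
    field_simp
  rw [h4] at h3
  refine h3.congr' ?_
  filter_upwards [eventually_gt_atTop 0] with t ht
  have ht0 : (0 : ℝ) < t := Nat.cast_pos.mpr ht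
  have h5 : (8 * Real.pi * (t : ℝ)) ^ (-(d : ℝ) / 2) = (√(8 * Real.pi) ^ d * √(t : ℝ) ^ d)⁻¹ := by
    rw [← mul_pow, ← Real.sqrt_mul (by positivity), neg_div, Real.rpow_neg (by positivity),
      Real.sqrt_eq_rpow, ← Real.rpow_mul_natCast (by positivity)]
    congr 2
    ring
  rw [Pi.div_apply, h5]
  have : √(8 * Real.pi) ≠ 0 := by positivity
  have : √(t : ℝ) ≠ 0 := by positivity
  field_simp
  rw [← hd]
  ring

end LocalLimit

/-- For fixed `n ≥ 1` and `d = n.choose 2`, as `t → ∞`: the asymptotic number of `n × 4t` partial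
Hadamard matrices, and the local limit theorem for the return probability of the walk. -/
theorem theorem2 (n d : ℕ) (hn : 1 ≤ n) (hd : d = n.choose 2) :
    ((fun t : ℕ => (numPartialHadamard n (4 * t) : ℝ)) ~[atTop]
      fun t : ℕ => (2 : ℝ) ^ (2 * (d : ℤ) - (n : ℤ) + 4 * (n : ℤ) * (t : ℤ) + 1) *
        (8 * Real.pi * (t : ℝ)) ^ (-(d : ℝ) / 2)) ∧
    ((fun t : ℕ => transitionProb n (4 * t) 0 0) ~[atTop]
      fun t : ℕ => (2 : ℝ) ^ (2 * (d : ℤ) - (n : ℤ) + 1) *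
        (8 * Real.pi * (t : ℝ)) ^ (-(d : ℝ) / 2)) := by
  subst hd
  have h := isEquivalent_transitionProb hn
  refine ⟨?_, h⟩
  have h1 := (IsEquivalent.refl (u := fun t : ℕ => (2 : ℝ) ^ (n * (4 * t))) (l := atTop)).mul h
  refine (h1.congr_left (.of_forall fun t => ?_)).congr_right (.of_forall fun t => ?_)
  · exact (numPartialHadamard_eq_transitionProb hn (4 * t)).symm
  · simp only [Pi.mul_apply]
    rw [← mul_assoc, ← zpow_natCast, ← zpow_add₀ two_ne_zero]
    congr 2
    push_cast
    ring
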